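/- **Setting.** Let $d$ be fixed and let $\boldsymbol X=(X_1,\dots,X_d)$ be a random vector in $\mathbb R^d$ with continuous joint distribution function. Put $p=d(d-1)/2$ and index vectors of $\mathbb R^p$ and $p\times p$ matrices by the pairs $k=(i,j)$ with $1\le i<j\le d$ (in any fixed order). Let $\boldsymbol X_1,\boldsymbol X_2,\dots$ be independent copies of $\boldsymbol X$, and for $k=(i,j)$ let $$\tau_{p,k}=\mathbb P\{(X_i-X_i^*)(X_j-X_j^*)>0\}-\mathbb P\{(X_i-X_i^*)(X_j-X_j^*)<0\},$$ where $\boldsymbol X^*$ is an independent copy of $\boldsymbol X$, be Kendall's tau of $(X_i,X_j)$. Let $$h_k(\boldsymbol x,\boldsymbol y)=2\cdot\mathbf 1\{(x_i-y_i)(x_j-y_j)>0\}-1,\qquad \hat{\boldsymbol\tau}_{np}=\frac{2}{n(n-1)}\sum_{1\le r<s\le n}h(\boldsymbol X_r,\boldsymbol X_s),$$ $g(\boldsymbol x)=\mathbb E\{h(\boldsymbol x,\boldsymbol X)\}-\boldsymbol\tau_p$ and $\boldsymbol\Sigma_p=4\,\mathrm{cov}\{g(\boldsymbol X)\}$. Let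 $\boldsymbol B$ be a $p\times L$ real matrix of rank $L$ with $L<p$. For a positive definite matrix $\boldsymbol A$, $\boldsymbol A^{-1/2}$ denotes the inverse of its principal (symmetric positive definite) square root. **Theorem.** Suppose that $H_0$ holds, i.e. $\boldsymbol\tau_p=\boldsymbol B\boldsymbol\beta$ for some $\boldsymbol\beta\in[-1,1]^L$. Let $\boldsymbol S_{np}$ and $\boldsymbol P_{np}$ be random $p\times p$ matrices, defined on the same probability space as the sample, such that, as $n\to\infty$, $n\boldsymbol S_{np}$ and $\boldsymbol P_{np}$ converge in probability to deterministic $p\times p$ matrices $\boldsymbol S_p$ and $\boldsymbol P_p$, respectively. Assume that $\boldsymbol S_p$ is positive definite and that, for all $n$, almost surely $\boldsymbol S_{np}$ is (symmetric) positive definite and $\boldsymbol P_{np}\boldsymbol\tau_p=\boldsymbol 0$. Let $$\boldsymbol S_p^\dagger=\boldsymbol S_p^{-1/2}\boldsymbol P_p\boldsymbol\Sigma_p\boldsymbol P_p^\top\boldsymbol S_p^{-1/2}.$$ Then, as $n\to\infty$, in distribution, $$\bigl\|\boldsymbol S_{np}^{-1/2}\boldsymbol P_{np}\hat{\boldsymbol\tau}_{np}\bigr\|_2^2\rightsquigarrow\sum_{r=1}^m\lambda_r\,\chi^2_{\nu_r}\qquad\text{and}\qquad\bigl\|\boldsymbol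 S_{np}^{-1/2}\boldsymbol P_{np}\hat{\boldsymbol\tau}_{np}\bigr\|_\infty\rightsquigarrow\|\boldsymbol Z_p\|_\infty,$$ where $\lambda_1,\dots,\lambda_m$ are the distinct nonzero eigenvalues of $\boldsymbol S_p^\dagger$, $\nu_r$ is the geometric multiplicity of $\lambda_r$, the $\chi^2_{\nu_r}$ are independent chi-squared variables with $\nu_r$ degrees of freedom, and $\boldsymbol Z_p\sim N_p(\boldsymbol 0,\boldsymbol S_p^\dagger)$. (If $m=0$, the empty sum is $0$.) -/

import Mathlib

open MeasureTheory ProbabilityTheory Filter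
open scoped Matrix

noncomputable section

/-- The index set of the vectorized above-diagonal part of a `d × d` matrix:
the `d (d - 1) / 2` pairs `(i, j)` with `i < j`. -/
abbrev UpperPair (d : ℕ) : Type := {q : Fin d × Fin d // q.1 < q.2}

/-- The vector `τ` of the pairwise Kendall's taus of a random vector with law `ν`: probability of
concordance minus probability of discordance of two independent draws from `ν`. -/
def kendallTauVec {d : ℕ} (ν : Measure (Fin d → ℝ)) (k : UpperPair d) : ℝ :=
  (ν.prod ν).real {z | 0 < (z.1 k.1.1 - z.2 k.1.1) * (z.1 k.1.2 - z.2 k.1.2)} -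
    (ν.prod ν).real {z | (z.1 k.1.1 - z.2 k.1.1) * (z.1 k.1.2 - z.2 k.1.2) < 0}

open Classical in
/-- The kernel `h(x, y)`, with entries `2 * 1{(x_i - y_i) (x_j - y_j) > 0} - 1`. -/
def kendallKernel {d : ℕ} (x y : Fin d → ℝ) (k : UpperPair d) : ℝ :=
  2 * (if 0 < (x k.1.1 - y k.1.1) * (x k.1.2 - y k.1.2) then 1 else 0) - 1

/-- The empirical Kendall's tau vector of the first `n` members `x 0, …, x (n - 1)` of a sample:
`2 / (n (n - 1))` times the sum of `h(x_r, x_s)` over `r < s < n`. -/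
def empiricalTauVec {d : ℕ} (n : ℕ) (x : ℕ → Fin d → ℝ) (k : UpperPair d) : ℝ :=
  2 / ((n : ℝ) * ((n : ℝ) - 1)) *
    ∑ s ∈ Finset.range n, ∑ r ∈ Finset.range s, kendallKernel (x r) (x s) k

/-- The function `g(x) = E h(x, X) - τ`, where `X` has law `ν`. -/
def kendallProj {d : ℕ} (ν : Measure (Fin d → ℝ)) (x : Fin d → ℝ) (k : UpperPair d) : ℝ :=
  ∫ y, kendallKernel x y k ∂ν - kendallTauVec ν k

/-- The asymptotic covariance matrix `Σ = 4 cov(g(X))` of the empirical Kendall's tau vector,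
where `X` has law `ν`. -/
def kendallCov {d : ℕ} (ν : Measure (Fin d → ℝ)) : Matrix (UpperPair d) (UpperPair d) ℝ :=
  Matrix.of fun k l => 4 * cov[fun x => kendallProj ν x k, fun x => kendallProj ν x l; ν]

open scoped MatrixOrder in
/-- The inverse `A^{-1/2}` of the principal square root of a positive definite matrix `A`. -/
def invSqrtMatrix {ι : Type*} [Fintype ι] [DecidableEq ι] (A : Matrix ι ι ℝ) : Matrix ι ι ℝ :=
  (CFC.sqrt A)⁻¹

/-- The distinct nonzero real eigenvalues of a matrix. -/
def nonzeroEigenvalues {ι : Type*} [Fintype ι] [DecidableEq ι] (M : Matrix ι ι ℝ) : Finset ℝ :=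
  (Module.End.finite_hasEigenvalue (Matrix.toLin' M)).toFinset.erase 0

/-- The geometric multiplicity of `a` as an eigenvalue of a matrix. -/
def geomMultiplicity {ι : Type*} [Fintype ι] [DecidableEq ι] (M : Matrix ι ι ℝ) (a : ℝ) : ℕ :=
  Module.finrank ℝ (Module.End.eigenspace (Matrix.toLin' M) a)

/-- The chi-squared distribution with `k` degrees of freedom: the law of the sum of the squares of
`k` independent standard normal variables. -/
def chiSquaredLaw (k : ℕ) : Measure ℝ :=
  (Measure.pi fun _ : Fin k => gaussianReal 0 1).map fun z => ∑ i, z i ^ 2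

instance chiSquaredLaw_isProbabilityMeasure (k : ℕ) : IsProbabilityMeasure (chiSquaredLaw k) :=
  Measure.isProbabilityMeasure_map (Measurable.aemeasurable (by fun_prop))

/-- The matrix `S^{-1/2} P C Pᵀ S^{-1/2}`. -/
def daggerMatrix {ι : Type*} [Fintype ι] [DecidableEq ι] (S P C : Matrix ι ι ℝ) :
    Matrix ι ι ℝ :=
  invSqrtMatrix S * P * C * Pᵀ * invSqrtMatrix S

end

/-!
Asymptotics of quadratic and maximum-type test statistics built on the empirical Kendall's tau
vector.

The empirical vector is a U-statistic of order two with the bounded symmetric kernel `h`. Continuity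
of the joint distribution function excludes ties (`measure_coord_eq_zero`), so that `h` has mean
`τ`. Hoeffding's decomposition writes the U-statistic as `τ`, plus twice the sample mean of the
projection `g`, plus a remainder built on a degenerate kernel; distinct pairs contribute
uncorrelated terms to the remainder, hence it is `O(1/n)` in `L²` (`integral_sq_degenerate_sum_le`)
and disappears after multiplication by `√n`. The multivariate central limit theorem
(`tendstoInDistribution_multivariateGaussian`, from the one-dimensional theorem and Lévy's
continuity theorem) then gives `√n (τ̂ - τ) ⇝ N(0, Σ)`.

Since `P n` annihilates `τ` almost surely, the standardized vector equals
`(n S n)^{-1/2} P n (√n (τ̂ - τ))`. The inverse square root is continuous on the positive definite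
matrices (`continuousOn_invSqrtMatrix`), and Slutsky's theorem gives the limit `N(0, S†)`
(`tendstoInDistribution_invSqrtMatrix_mulVec`). The two statements follow by continuous mapping; for
the first, the squared norm of a vector with law `N(0, S†)` is a sum of squares of independent
standard normal variables weighted by the eigenvalues of `S†`, and grouping equal eigenvalues
produces the chi-squared variables (`map_norm_sq_multivariateGaussian_eq_chiSquared`).
-/

/-! ### The inverse square root of a positive definite matrix -/

section InvSqrt

variable {ι : Type*} [Fintype ι]

lemma isClosed_posSemidef : IsClosed {A : Matrix ι ι ℝ | A.PosSemidef} := by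
  have : {A : Matrix ι ι ℝ | A.PosSemidef} =
      {A | Aᵀ = A} ∩ ⋂ x : ι → ℝ, {A | 0 ≤ x ⬝ᵥ (A *ᵥ x)} := by
    ext A
    simp [Matrix.posSemidef_iff_dotProduct_mulVec, Matrix.IsHermitian]
  rw [this]
  refine IsClosed.inter (isClosed_eq (by fun_prop) (by fun_prop)) (isClosed_iInter fun x => ?_)
  exact isClosed_le continuous_const (by fun_prop)

variable [DecidableEq ι]

open scoped MatrixOrder Matrix.Norms.L2Operator in
lemma continuousOn_sqrt_posSemidef :
    ContinuousOn (fun A : Matrix ι ι ℝ => CFC.sqrt A) {A | A.PosSemidef} := by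
  refine ContinuousOn.cfcₙ_nnreal_of_mem_nhdsSet (s := Set.univ) NNReal.sqrt ?_ continuousOn_id ?_
  · exact Filter.univ_mem
  · intro A hA; exact Matrix.PosSemidef.nonneg hA

open scoped MatrixOrder in
lemma isUnit_det_sqrt {A : Matrix ι ι ℝ} (hA : A.PosDef) : IsUnit (CFC.sqrt A).det := by
  rw [← Matrix.isUnit_iff_isUnit_det, CFC.isUnit_sqrt_iff A hA.posSemidef.nonneg]
  exact hA.isUnit

lemma continuousOn_invSqrtMatrix :
    ContinuousOn (fun A : Matrix ι ι ℝ => invSqrtMatrix A) {A | A.PosDef} := by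
  intro A hA
  have h1 := (continuousOn_sqrt_posSemidef.mono
    (fun A (hA : A.PosDef) => hA.posSemidef)).continuousWithinAt hA
  refine ContinuousAt.comp_continuousWithinAt (g := Inv.inv) ?_ h1
  refine continuousAt_matrix_inv _ ?_
  simp only [Ring.inverse_eq_inv']
  exact continuousAt_inv₀ (isUnit_det_sqrt hA).ne_zero

open scoped MatrixOrder in
lemma invSqrtMatrix_transpose (A : Matrix ι ι ℝ) :
    (invSqrtMatrix A)ᵀ = invSqrtMatrix A := by
  have h : (CFC.sqrt A)ᵀ = CFC.sqrt A := by
    simpa using (Matrix.nonneg_iff_posSemidef.1 (CFC.sqrt_nonneg A)).isHermitian.eq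
  rw [invSqrtMatrix, Matrix.transpose_nonsing_inv, h]

open scoped MatrixOrder in
lemma invSqrtMatrix_smul {A : Matrix ι ι ℝ} (hA : A.PosDef) {c : ℝ} (hc : 0 < c) :
    invSqrtMatrix (c • A) = (√c)⁻¹ • invSqrtMatrix A := by
  have h : CFC.sqrt (c • A) = √c • CFC.sqrt A := by
    refine CFC.sqrt_unique ?_ ?_
    · rw [smul_mul_smul_comm, Real.mul_self_sqrt hc.le,
        CFC.sqrt_mul_sqrt_self A hA.posSemidef.nonneg]
    · exact ((Matrix.nonneg_iff_posSemidef.1 (CFC.sqrt_nonneg A)).smul (Real.sqrt_nonneg c)).nonneg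
  rw [invSqrtMatrix, invSqrtMatrix, h]
  have : Invertible √c := invertibleOfNonzero (Real.sqrt_pos.2 hc).ne'
  rw [Matrix.inv_smul _ _ (isUnit_det_sqrt hA), invOf_eq_inv]

/-- The positive definite matrices form a Borel set: they are the positive semidefinite matrices
with nonzero determinant. -/
lemma measurableSet_posDef [MeasurableSpace (Matrix ι ι ℝ)] [BorelSpace (Matrix ι ι ℝ)] :
    MeasurableSet {A : Matrix ι ι ℝ | A.PosDef} := by
  have : {A : Matrix ι ι ℝ | A.PosDef} = {A | A.PosSemidef} ∩ {A | A.det ≠ 0} := by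
    ext A
    exact ⟨fun h => ⟨h.posSemidef, h.posSemidef.posDef_iff_det_ne_zero.1 h⟩,
      fun h => h.1.posDef_iff_det_ne_zero.2 h.2⟩
  rw [this]
  refine isClosed_posSemidef.measurableSet.inter (IsOpen.measurableSet ?_)
  exact isOpen_ne_fun (by fun_prop) (by fun_prop)

end InvSqrt

/-! ### The squared norm of a Gaussian vector -/

section QuadraticForm

variable {ι : Type*} [Fintype ι] [DecidableEq ι] {M : Matrix ι ι ℝ}

lemma nonzeroEigenvalues_eq_image (hM : M.IsHermitian) :
    nonzeroEigenvalues M = (Finset.univ.image hM.eigenvalues).erase 0 := by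
  ext a
  simp only [nonzeroEigenvalues, Finset.mem_erase, Set.Finite.mem_toFinset,
    Finset.mem_image, Finset.mem_univ, true_and]
  refine and_congr_right fun _ => ?_
  change Module.End.HasEigenvalue _ _ ↔ _
  rw [Module.End.hasEigenvalue_iff_mem_spectrum, Matrix.spectrum_toLin',
    hM.spectrum_real_eq_range_eigenvalues, Set.mem_range]

/-- For a symmetric matrix the geometric multiplicity of `a` is the number of times `a` occurs in
the list of eigenvalues: `M - a` is orthogonally similar to the diagonal matrix of the
`eigenvalues - a`. -/
lemma geomMultiplicity_eq_card (hM : M.IsHermitian) (a : ℝ) :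
    geomMultiplicity M a = (Finset.univ.filter fun i => hM.eigenvalues i = a).card := by
  have hrank : (M - a • (1 : Matrix ι ι ℝ)).rank =
      Fintype.card {i // hM.eigenvalues i - a ≠ 0} := by
    set U := hM.eigenvectorUnitary
    have hU : IsUnit (U : Matrix ι ι ℝ).det :=
      (Matrix.isUnit_iff_isUnit_det _).1 (Unitary.toUnits U).isUnit
    have hU' : IsUnit (star (U : Matrix ι ι ℝ)).det :=
      (Matrix.isUnit_iff_isUnit_det _).1 (Unitary.toUnits (star U)).isUnit
    have h1 : M - a • (1 : Matrix ι ι ℝ) =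
        U * Matrix.diagonal (fun i => hM.eigenvalues i - a) * star (U : Matrix ι ι ℝ) := by
      have h2 : Matrix.diagonal (fun i => hM.eigenvalues i - a) =
          Matrix.diagonal hM.eigenvalues - a • (1 : Matrix ι ι ℝ) := by
        ext i j
        by_cases h : i = j <;> simp [Matrix.diagonal, h]
      have h3 := hM.spectral_theorem
      rw [Unitary.conjStarAlgAut_apply] at h3
      have h4 : (U : Matrix ι ι ℝ) * star (U : Matrix ι ι ℝ) = 1 := Unitary.coe_mul_star_self U
      rw [h2, mul_sub, sub_mul, mul_smul_comm, mul_one, smul_mul_assoc, h4]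
      conv_lhs => rw [h3]
      rfl
    rw [h1, Matrix.rank_mul_eq_left_of_isUnit_det _ _ hU',
      Matrix.rank_mul_eq_right_of_isUnit_det _ _ hU, Matrix.rank_diagonal]
  have hker := LinearMap.finrank_range_add_finrank_ker
    (Matrix.toLin' (M - a • (1 : Matrix ι ι ℝ)))
  have h5 : Matrix.toLin' (M - a • (1 : Matrix ι ι ℝ)) =
      Matrix.toLin' M - a • 1 := by
    rw [map_sub, map_smul, Matrix.toLin'_one]; rfl
  rw [geomMultiplicity, Module.End.eigenspace_def, ← h5]
  rw [Matrix.toLin'_apply', ← Matrix.rank, hrank, Module.finrank_fintype_fun_eq_card,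
    Fintype.card_subtype] at hker
  have h6 := Finset.card_filter_add_card_filter_not (s := Finset.univ)
    (fun i => hM.eigenvalues i = a)
  simp only [sub_ne_zero, Finset.card_univ] at hker h6
  rw [Matrix.toLin'_apply']
  simp only [ne_eq] at hker
  omega

/-- The characteristic function of a sum of independent real variables, each a function of one
coordinate, is the product of the characteristic functions. -/
lemma charFun_map_sum_pi {κ : Type*} [Fintype κ] {E : κ → Type*} [∀ i, MeasurableSpace (E i)]
    (m : ∀ i, Measure (E i)) [∀ i, IsProbabilityMeasure (m i)] (f : ∀ i, E i → ℝ)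
    (hf : ∀ i, Measurable (f i)) (t : ℝ) :
    charFun ((Measure.pi m).map fun x => ∑ i, f i (x i)) t =
      ∏ i, charFun ((m i).map (f i)) t := by
  simp_rw [charFun_apply_real]
  have hsum : Measurable fun x : (∀ i, E i) => ∑ i, f i (x i) :=
    Finset.measurable_sum _ fun i _ => (hf i).comp (measurable_pi_apply i)
  rw [integral_map hsum.aemeasurable (by fun_prop)]
  have : ∀ i, ∫ x, Complex.exp (t * x * Complex.I) ∂((m i).map (f i)) =
      ∫ x, Complex.exp (t * f i x * Complex.I) ∂(m i) :=
    fun i => integral_map (hf i).aemeasurable (by fun_prop)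
  simp_rw [this, ← integral_fintype_prod_eq_prod, ← Complex.exp_sum]
  congr with x
  push_cast
  rw [Finset.mul_sum, Finset.sum_mul]

open scoped MatrixOrder in
/-- In the eigenbasis of the covariance matrix, the squared norm of a centred Gaussian vector is
the sum of the squares of independent standard normal variables, weighted by the eigenvalues:
`‖M^{1/2} x‖² = ⟪x, M x⟫`. -/
lemma map_norm_sq_multivariateGaussian (hM : M.PosSemidef) :
    (multivariateGaussian 0 M).map (fun z => ‖z‖ ^ 2) =
      (Measure.pi fun _ : ι => gaussianReal 0 1).map
        fun x => ∑ i, hM.isHermitian.eigenvalues i * x i ^ 2 := by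
  set b := hM.isHermitian.eigenvectorBasis with hb
  rw [multivariateGaussian, stdGaussian_eq_map_pi_orthonormalBasis b,
    Measure.map_map (by fun_prop) (by fun_prop), Measure.map_map (by fun_prop) (by fun_prop)]
  congr 1
  ext x
  simp only [Function.comp_apply, zero_add]
  set y := ∑ i, x i • b i with hy
  have h1 : Matrix.toEuclideanCLM (𝕜 := ℝ) M y =
      ∑ i, (x i * hM.isHermitian.eigenvalues i) • b i := by
    rw [hy, map_sum]
    refine Finset.sum_congr rfl fun i _ => ?_
    rw [map_smul, mul_smul]
    congr 1
    ext j
    have := congrFun (hM.isHermitian.mulVec_eigenvectorBasis i) j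
    simpa [← hb] using this
  have h2 : ‖Matrix.toEuclideanCLM (𝕜 := ℝ) (CFC.sqrt M) y‖ ^ 2 =
      inner ℝ y (Matrix.toEuclideanCLM (𝕜 := ℝ) M y) := by
    have h3 : Matrix.toEuclideanCLM (𝕜 := ℝ) M = Matrix.toEuclideanCLM (𝕜 := ℝ) (CFC.sqrt M) *
        Matrix.toEuclideanCLM (𝕜 := ℝ) (CFC.sqrt M) := by
      rw [← map_mul, CFC.sqrt_mul_sqrt_self _ hM.nonneg]
    have h4 : IsSelfAdjoint (Matrix.toEuclideanCLM (𝕜 := ℝ) (CFC.sqrt M)) :=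
      (CFC.sqrt_nonneg M).isSelfAdjoint.map _
    rw [h3, mul_apply_eq_comp, ← ContinuousLinearMap.adjoint_inner_left, h4.adjoint_eq,
      real_inner_self_eq_norm_sq]
  rw [h2, h1, hy, b.orthonormal.inner_sum]
  refine Finset.sum_congr rfl fun i _ => ?_
  simp
  ring

/-- The law of the squared norm of a centred Gaussian vector with covariance matrix `M` is that of
the combination of independent chi-squared variables whose weights are the distinct nonzero
eigenvalues of `M` and whose degrees of freedom are their multiplicities: grouping equal
eigenvalues identifies the two characteristic functions, as the eigenvalue `0` contributes the
factor `1`. -/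
lemma map_norm_sq_multivariateGaussian_eq_chiSquared (hM : M.PosSemidef) :
    (multivariateGaussian 0 M).map (fun z => ‖z‖ ^ 2) =
      (Measure.pi fun a : nonzeroEigenvalues M => chiSquaredLaw (geomMultiplicity M a)).map
        fun q => ∑ a : nonzeroEigenvalues M, (a : ℝ) * q a := by
  have hchi : ∀ k, chiSquaredLaw k =
      (Measure.pi fun _ : Fin k => gaussianReal 0 1).map fun z => ∑ i, z i ^ 2 := fun k => rfl
  have hprob : IsProbabilityMeasure ((multivariateGaussian 0 M).map (fun z => ‖z‖ ^ 2)) :=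
    Measure.isProbabilityMeasure_map (by fun_prop)
  have hprob' : IsProbabilityMeasure ((Measure.pi fun a : nonzeroEigenvalues M =>
      chiSquaredLaw (geomMultiplicity M a)).map
        fun q => ∑ a : nonzeroEigenvalues M, (a : ℝ) * q a) :=
    Measure.isProbabilityMeasure_map (Measurable.aemeasurable (by fun_prop))
  refine Measure.ext_of_charFun ?_
  ext t
  set φ : ℝ → ℂ := charFun ((gaussianReal 0 1).map fun x => x ^ 2) with hφ
  have hL : charFun ((multivariateGaussian 0 M).map (fun z => ‖z‖ ^ 2)) t =
      ∏ i, φ (hM.isHermitian.eigenvalues i * t) := by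
    rw [map_norm_sq_multivariateGaussian hM,
      charFun_map_sum_pi _ (fun i x => hM.isHermitian.eigenvalues i * x ^ 2) (by fun_prop)]
    refine Finset.prod_congr rfl fun i _ => ?_
    rw [hφ, ← charFun_map_mul, Measure.map_map (by fun_prop) (by fun_prop)]
    rfl
  have hR : charFun ((Measure.pi fun a : nonzeroEigenvalues M =>
      chiSquaredLaw (geomMultiplicity M a)).map
        fun q => ∑ a : nonzeroEigenvalues M, (a : ℝ) * q a) t =
      ∏ a : nonzeroEigenvalues M, φ (a * t) ^ geomMultiplicity M a := by
    rw [charFun_map_sum_pi _ (fun (a : nonzeroEigenvalues M) x => (a : ℝ) * x) (by fun_prop)]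
    refine Finset.prod_congr rfl fun a _ => ?_
    rw [charFun_map_mul, hchi, charFun_map_sum_pi _ (fun _ x => x ^ 2) (by fun_prop)]
    simp [hφ]
  have hφ0 : φ 0 = 1 := by
    have : IsProbabilityMeasure ((gaussianReal 0 1).map fun x => x ^ 2) :=
      Measure.isProbabilityMeasure_map (by fun_prop)
    simp [hφ]
  rw [hL, hR, Finset.prod_coe_sort (nonzeroEigenvalues M)
    (fun a => φ (a * t) ^ geomMultiplicity M a), nonzeroEigenvalues_eq_image hM.isHermitian,
    Finset.prod_erase _ (by simp [hφ0]),
    Finset.prod_comp (fun a => φ (a * t)) hM.isHermitian.eigenvalues]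
  refine Finset.prod_congr rfl fun a _ => ?_
  rw [geomMultiplicity_eq_card hM.isHermitian]

end QuadraticForm

/-! ### Convergence in probability and in distribution -/

section Convergence

variable {Ω : Type*} [MeasurableSpace Ω] {μ : Measure Ω}

lemma tendstoInMeasure_pi {ι κ : Type*} [Fintype κ] {E : κ → Type*}
    [∀ k, PseudoEMetricSpace (E k)] {l : Filter ι} {f : ι → Ω → ∀ k, E k} {g : Ω → ∀ k, E k}
    (h : ∀ k, TendstoInMeasure μ (fun i ω => f i ω k) l (fun ω => g ω k)) :
    TendstoInMeasure μ f l g := by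
  intro ε hε
  have hsum := tendsto_finsetSum Finset.univ fun k _ => h k ε hε
  simp only [Finset.sum_const_zero] at hsum
  refine tendsto_of_tendsto_of_tendsto_of_le_of_le tendsto_const_nhds hsum (fun i => zero_le)
    fun i => ?_
  refine le_trans (measure_mono ?_) (measure_iUnion_fintype_le μ _)
  intro ω hω
  simp only [Set.mem_ofPred_eq, edist_pi_def, Set.mem_iUnion] at hω ⊢
  obtain ⟨k, -, hk⟩ := (Finset.le_sup_iff (by simpa using hε)).1 hω
  exact ⟨k, hk⟩

lemma tendstoInMeasure_prodMk {ι E F : Type*} [PseudoEMetricSpace E] [PseudoEMetricSpace F]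
    {l : Filter ι} {f : ι → Ω → E} {f' : ι → Ω → F} {g : Ω → E} {g' : Ω → F}
    (h : TendstoInMeasure μ f l g) (h' : TendstoInMeasure μ f' l g') :
    TendstoInMeasure μ (fun i ω => (f i ω, f' i ω)) l (fun ω => (g ω, g' ω)) := by
  intro ε hε
  have hsum := (h ε hε).add (h' ε hε)
  rw [add_zero] at hsum
  refine tendsto_of_tendsto_of_tendsto_of_le_of_le tendsto_const_nhds hsum (fun i => zero_le)
    fun i => ?_
  refine le_trans (measure_mono ?_) (measure_union_le _ _)
  intro ω hω
  simpa [Prod.edist_eq] using hω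

/-- Continuous mapping theorem for convergence in probability to a constant `c`. Continuity is
only needed at `c`, and only within a set in which the variables almost surely lie. -/
lemma MeasureTheory.TendstoInMeasure.comp_continuousWithinAt {ι E F : Type*} [PseudoEMetricSpace E]
    [PseudoEMetricSpace F] {l : Filter ι} {f : ι → Ω → E} {c : E} {s : Set E} {φ : E → F}
    (h : TendstoInMeasure μ f l fun _ => c) (hφ : ContinuousWithinAt φ s c)
    (hs : ∀ᶠ i in l, ∀ᵐ ω ∂μ, f i ω ∈ s) :
    TendstoInMeasure μ (fun i ω => φ (f i ω)) l fun _ => φ c := by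
  intro ε hε
  obtain ⟨δ, hδ, hδε⟩ := EMetric.mem_nhdsWithin_iff.1
    (hφ (Metric.eball_mem_nhds (φ c) hε))
  refine tendsto_of_tendsto_of_tendsto_of_le_of_le' tendsto_const_nhds (h δ hδ)
    (Eventually.of_forall fun i => zero_le) ?_
  filter_upwards [hs] with i hi
  refine measure_mono_ae ?_
  filter_upwards [hi] with ω hω hω'
  by_contra hlt
  exact absurd (hδε ⟨not_le.1 hlt, hω⟩) (not_lt.2 hω')

/-- A sequence of square integrable variables whose second moments tend to `0` tends to `0` in
probability. -/
lemma tendstoInMeasure_zero_of_integral_sq [IsFiniteMeasure μ] {f : ℕ → Ω → ℝ}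
    (hf : ∀ n, MemLp (f n) 2 μ) (h : Tendsto (fun n => ∫ ω, f n ω ^ 2 ∂μ) atTop (nhds 0)) :
    TendstoInMeasure μ f atTop 0 := by
  refine tendstoInMeasure_of_tendsto_eLpNorm two_ne_zero (fun n => (hf n).1)
    aestronglyMeasurable_zero ?_
  simp only [sub_zero]
  have h1 : ∀ n, eLpNorm (f n) 2 μ = ENNReal.ofReal ((∫ ω, f n ω ^ 2 ∂μ) ^ (2⁻¹ : ℝ)) := by
    intro n
    rw [(hf n).eLpNorm_eq_integral_rpow_norm two_ne_zero (by simp)]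
    simp
  simp_rw [h1]
  have h2 := (h.rpow_const (p := (2⁻¹ : ℝ)) (Or.inr (by norm_num)))
  rw [Real.zero_rpow (by norm_num)] at h2
  simpa using ENNReal.tendsto_ofReal h2

/-- Convergence in distribution only depends on the law of the limit. -/
lemma MeasureTheory.TendstoInDistribution.of_map_eq {ι Ω₁ Ω₂ E : Type*} [MeasurableSpace Ω₁]
    [MeasurableSpace Ω₂] [TopologicalSpace E] [MeasurableSpace E] [OpensMeasurableSpace E]
    [IsProbabilityMeasure μ] {μ₁ : Measure Ω₁} [IsProbabilityMeasure μ₁] {μ₂ : Measure Ω₂}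
    [IsProbabilityMeasure μ₂] {l : Filter ι} {f : ι → Ω → E} {Z₁ : Ω₁ → E} {Z₂ : Ω₂ → E}
    (h : TendstoInDistribution f l Z₁ (fun _ => μ) μ₁) (hZ : AEMeasurable Z₂ μ₂)
    (hlaw : μ₁.map Z₁ = μ₂.map Z₂) : TendstoInDistribution f l Z₂ (fun _ => μ) μ₂ where
  forall_aemeasurable := h.forall_aemeasurable
  aemeasurable_limit := hZ
  tendsto := by
    have heq : (⟨μ₁.map Z₁, Measure.isProbabilityMeasure_map h.aemeasurable_limit⟩ :
        ProbabilityMeasure E) = ⟨μ₂.map Z₂, Measure.isProbabilityMeasure_map hZ⟩ :=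
      Subtype.ext hlaw
    exact heq ▸ h.tendsto

end Convergence

/-! ### The multivariate central limit theorem -/

section CLT

variable {Ω ι : Type*} [MeasurableSpace Ω] {μ : Measure Ω} [IsProbabilityMeasure μ] [Fintype ι]

/-- The covariance matrix of a random vector. -/
noncomputable def covMatrix (Y : Ω → ι → ℝ) (μ : Measure Ω) : Matrix ι ι ℝ :=
  Matrix.of fun k l => cov[fun ω => Y ω k, fun ω => Y ω l; μ]

lemma variance_dotProduct {Y : Ω → ι → ℝ} (hY : ∀ k, MemLp (fun ω => Y ω k) 2 μ) (t : ι → ℝ) :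
    Var[fun ω => t ⬝ᵥ Y ω; μ] = t ⬝ᵥ (covMatrix Y μ *ᵥ t) := by
  have hm : ∀ k, MemLp (fun ω => t k * Y ω k) 2 μ := fun k => (hY k).const_mul (t k)
  simp only [dotProduct, Matrix.mulVec]
  rw [variance_fun_sum hm]
  refine Finset.sum_congr rfl fun k _ => ?_
  rw [Finset.mul_sum]
  refine Finset.sum_congr rfl fun l _ => ?_
  rw [covariance_const_mul_left, covariance_const_mul_right, covMatrix, Matrix.of_apply]
  ring

lemma posSemidef_covMatrix {Y : Ω → ι → ℝ} (hY : ∀ k, MemLp (fun ω => Y ω k) 2 μ) :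
    (covMatrix Y μ).PosSemidef := by
  refine Matrix.PosSemidef.of_dotProduct_mulVec_nonneg ?_ fun t => ?_
  · ext k l
    simp [covMatrix, covariance_comm]
  · rw [star_trivial, ← variance_dotProduct hY]
    exact variance_nonneg _ _

/-- The multivariate central limit theorem, from the one-dimensional one and Lévy's continuity
theorem: the characteristic function at `t` of the normalized sum is that at `1` of the normalized
sum of the real variables `⟪t, Y n⟫`. -/
theorem tendstoInDistribution_multivariateGaussian [DecidableEq ι] {Y : ℕ → Ω → ι → ℝ}
    (hY : ∀ k, MemLp (fun ω => Y 0 ω k) 2 μ) (h0 : ∀ k, ∫ ω, Y 0 ω k ∂μ = 0)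
    (hindep : iIndepFun Y μ) (hident : ∀ n, IdentDistrib (Y n) (Y 0) μ μ) :
    TendstoInDistribution
      (fun (n : ℕ) ω => WithLp.toLp 2 ((√n)⁻¹ • ∑ r ∈ Finset.range n, Y r ω)) atTop
      (id : EuclideanSpace ℝ ι → EuclideanSpace ℝ ι) (fun _ => μ)
      (multivariateGaussian 0 (covMatrix (Y 0) μ)) := by
  have hae : ∀ n : ℕ, AEMeasurable (fun ω =>
      (WithLp.toLp 2 ((√n)⁻¹ • ∑ r ∈ Finset.range n, Y r ω) : EuclideanSpace ℝ ι)) μ := fun n =>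
    (by fun_prop : Measurable (WithLp.toLp 2 : (ι → ℝ) → EuclideanSpace ℝ ι)).comp_aemeasurable
      ((Finset.aemeasurable_fun_sum (Finset.range n)
        fun r _ => (hident r).aemeasurable_fst).const_smul (√n)⁻¹)
  refine ⟨hae, aemeasurable_id, ?_⟩
  refine ProbabilityMeasure.tendsto_iff_tendsto_charFun.2 fun t => ?_
  simp only [ProbabilityMeasure.coe_mk, Measure.map_id]
  rw [charFun_multivariateGaussian (posSemidef_covMatrix hY)]
  have hdot : Measurable fun y : ι → ℝ => t.ofLp ⬝ᵥ y := by
    unfold dotProduct; fun_prop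
  have hmean : ∫ ω, t.ofLp ⬝ᵥ Y 0 ω ∂μ = 0 := by
    simp only [dotProduct]
    rw [integral_finsetSum _ fun k _ => ((hY k).integrable one_le_two).const_mul _]
    simp [integral_const_mul, h0]
  have hlim := tendstoInDistribution_inv_sqrt_mul_sum_sub (P := μ)
    (X := fun n ω => t.ofLp ⬝ᵥ Y n ω)
    (Y := id) (P' := gaussianReal 0 Var[fun ω => t.ofLp ⬝ᵥ Y 0 ω; μ].toNNReal)
    HasLaw.id (memLp_finsetSum _ fun k _ => (hY k).const_mul _)
    (hindep.comp (fun _ y => t.ofLp ⬝ᵥ y) fun _ => hdot)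
    (fun n => (hident n).comp hdot)
  -- Evaluating the limit of the real variables at `1` gives that of the vectors at `t`.
  have hlim1 := ProbabilityMeasure.tendsto_iff_tendsto_charFun.1 hlim.tendsto 1
  simp only [ProbabilityMeasure.coe_mk, Measure.map_id, charFun_gaussianReal] at hlim1
  convert hlim1 using 2 with n
  · rw [charFun_apply, charFun_apply_real, integral_map _ (by fun_prop),
      integral_map _ (by fun_prop)]
    · refine integral_congr_ae (ae_of_all _ fun ω => ?_)
      simp only [hmean, EuclideanSpace.inner_eq_star_dotProduct, star_trivial, mul_zero, sub_zero,
        Complex.ofReal_one, one_mul, dotProduct_smul, dotProduct_sum, smul_eq_mul]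
    · exact hlim.forall_aemeasurable n
    · exact hae n
  · rw [variance_dotProduct hY, Real.coe_toNNReal _ (by
      simpa using (posSemidef_covMatrix hY).dotProduct_mulVec_nonneg t.ofLp)]
    simp

end CLT

/-! ### U-statistics of order two -/

section UStatistic

/-- Hoeffding's decomposition of the sum of a kernel over the pairs of a sample. -/
lemma sum_pairs_eq_hoeffding {𝓧 : Type*} (h : 𝓧 → 𝓧 → ℝ) (g : 𝓧 → ℝ) (θ : ℝ) (x : ℕ → 𝓧) (n : ℕ) :
    ∑ s ∈ Finset.range n, ∑ r ∈ Finset.range s, h (x r) (x s) =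
      ∑ s ∈ Finset.range n, ∑ r ∈ Finset.range s, (h (x r) (x s) - θ - g (x r) - g (x s)) +
        ((n : ℝ) - 1) * ∑ r ∈ Finset.range n, g (x r) + (n : ℝ) * (n - 1) / 2 * θ := by
  induction n with
  | zero => simp
  | succ n ih =>
    rw [Finset.sum_range_succ, ih, Finset.sum_range_succ (fun s => ∑ r ∈ Finset.range s, _),
      Finset.sum_range_succ (fun r => g (x r))]
    simp only [Finset.sum_sub_distrib, Finset.sum_const, Finset.card_range, nsmul_eq_mul]
    push_cast
    ring

variable {Ω 𝓧 : Type*} [MeasurableSpace Ω] [MeasurableSpace 𝓧] {μ : Measure Ω}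
  {ν : Measure 𝓧} {X : ℕ → Ω → 𝓧}

lemma aemeasurable_kernel {ψ : 𝓧 → 𝓧 → ℝ} (hψ : Measurable (Function.uncurry ψ))
    (hlaw : ∀ r, HasLaw (X r) ν μ) (a b : ℕ) : AEMeasurable (fun ω => ψ (X a ω) (X b ω)) μ :=
  hψ.comp_aemeasurable ((hlaw a).aemeasurable.prodMk (hlaw b).aemeasurable)

variable [IsProbabilityMeasure μ] [IsProbabilityMeasure ν]

/-- A factor `ψ(X_c, X_m)` of a degenerate kernel makes the expectation vanish when the other
factor does not involve `X_m`: integrate over `X_m` first. -/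
lemma integral_degenerate_mul_eq_zero {ψ : 𝓧 → 𝓧 → ℝ} (hψ : Measurable (Function.uncurry ψ))
    {C : ℝ} (hC : ∀ x y, |ψ x y| ≤ C) (h0 : ∀ x, ∫ y, ψ x y ∂ν = 0)
    (hindep : iIndepFun X μ) (hlaw : ∀ r, HasLaw (X r) ν μ) {a b c m : ℕ}
    (ha : a ≠ m) (hb : b ≠ m) (hc : c ≠ m) :
    ∫ ω, ψ (X a ω) (X b ω) * ψ (X c ω) (X m ω) ∂μ = 0 := by
  have hm : ∀ r, AEMeasurable (X r) μ := fun r => (hlaw r).aemeasurable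
  have hU : IndepFun (fun ω => (X a ω, X b ω, X c ω)) (X m) μ := by
    have h := hindep.indepFun_finset₀ {a, b, c} {m} (by simp [ha.symm, hb.symm, hc.symm]) hm
    exact h.comp (φ := fun u : ∀ i : ({a, b, c} : Finset ℕ), 𝓧 =>
        (u ⟨a, by simp⟩, u ⟨b, by simp⟩, u ⟨c, by simp⟩))
      (ψ := fun u : ∀ i : ({m} : Finset ℕ), 𝓧 => u ⟨m, by simp⟩) (by fun_prop) (by fun_prop)
  have hUm : AEMeasurable (fun ω => (X a ω, X b ω, X c ω)) μ :=
    (hm a).prodMk ((hm b).prodMk (hm c))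
  have hmap := (indepFun_iff_map_prod_eq_prod_map_map hUm (hm m)).1 hU
  have hφ : Measurable fun z : (𝓧 × 𝓧 × 𝓧) × 𝓧 => ψ z.1.1 z.1.2.1 * ψ z.1.2.2 z.2 :=
    (hψ.comp (by fun_prop : Measurable fun z : (𝓧 × 𝓧 × 𝓧) × 𝓧 => (z.1.1, z.1.2.1))).mul
      (hψ.comp (by fun_prop : Measurable fun z : (𝓧 × 𝓧 × 𝓧) × 𝓧 => (z.1.2.2, z.2)))
  have : IsProbabilityMeasure (μ.map fun ω => (X a ω, X b ω, X c ω)) :=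
    Measure.isProbabilityMeasure_map hUm
  have h1 : ∫ ω, ψ (X a ω) (X b ω) * ψ (X c ω) (X m ω) ∂μ =
      ∫ z, ψ z.1.1 z.1.2.1 * ψ z.1.2.2 z.2
        ∂((μ.map fun ω => (X a ω, X b ω, X c ω)).prod ν) := by
    rw [← (hlaw m).map_eq, ← hmap, integral_map (hUm.prodMk (hm m)) hφ.aestronglyMeasurable]
  rw [h1, integral_prod]
  · simp [integral_const_mul, h0]
  · refine Integrable.of_bound hφ.aestronglyMeasurable (C * C) (ae_of_all _ fun z => ?_)
    rw [Real.norm_eq_abs, abs_mul]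
    exact mul_le_mul (hC _ _) (hC _ _) (abs_nonneg _) ((abs_nonneg _).trans (hC z.1.1 z.1.1))

/-- The second moment of the sum of a degenerate symmetric kernel over the pairs of `n` independent
variables is of the order of the number of pairs, since distinct pairs are uncorrelated. -/
lemma integral_sq_degenerate_sum_le {ψ : 𝓧 → 𝓧 → ℝ} (hψ : Measurable (Function.uncurry ψ))
    (hsymm : ∀ x y, ψ x y = ψ y x) {C : ℝ} (hC : ∀ x y, |ψ x y| ≤ C)
    (h0 : ∀ x, ∫ y, ψ x y ∂ν = 0) (hindep : iIndepFun X μ) (hlaw : ∀ r, HasLaw (X r) ν μ)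
    (n : ℕ) :
    ∫ ω, (∑ s ∈ Finset.range n, ∑ r ∈ Finset.range s, ψ (X r ω) (X s ω)) ^ 2 ∂μ ≤
      C ^ 2 * n ^ 2 := by
  have hmeas := aemeasurable_kernel (μ := μ) hψ hlaw
  have hmem : ∀ a b, MemLp (fun ω => ψ (X a ω) (X b ω)) 2 μ := fun a b =>
    MemLp.of_bound (hmeas a b).aestronglyMeasurable C (ae_of_all _ fun ω => hC _ _)
  have hint : ∀ a b c e, Integrable (fun ω => ψ (X a ω) (X b ω) * ψ (X c ω) (X e ω)) μ :=
    fun a b c e => (hmem a b).integrable_mul (hmem c e)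
  induction n with
  | zero => simp
  | succ n ih =>
    set T : Ω → ℝ := fun ω => ∑ s ∈ Finset.range n, ∑ r ∈ Finset.range s, ψ (X r ω) (X s ω)
      with hT
    -- The pairs that involve the new variable.
    set D : Ω → ℝ := fun ω => ∑ r ∈ Finset.range n, ψ (X r ω) (X n ω) with hD
    have hTm : MemLp T 2 μ := memLp_finsetSum _ fun s _ => memLp_finsetSum _ fun r _ => hmem r s
    have hDm : MemLp D 2 μ := memLp_finsetSum _ fun r _ => hmem r n
    have hTD : ∫ ω, T ω * D ω ∂μ = 0 := by
      simp only [hT, hD, Finset.sum_mul, Finset.mul_sum]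
      rw [integral_finsetSum _ fun i _ => integrable_finsetSum _ fun s _ =>
        integrable_finsetSum _ fun r _ => hint _ _ _ _]
      refine Finset.sum_eq_zero fun i hi => ?_
      rw [integral_finsetSum _ fun s _ => integrable_finsetSum _ fun r _ => hint _ _ _ _]
      refine Finset.sum_eq_zero fun s hs => ?_
      rw [integral_finsetSum _ fun r _ => hint _ _ _ _]
      refine Finset.sum_eq_zero fun r hr => ?_
      rw [Finset.mem_range] at hs hr hi
      exact integral_degenerate_mul_eq_zero hψ hC h0 hindep hlaw
        (hr.trans hs).ne hs.ne hi.ne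
    -- The symmetry of `ψ` puts the off-diagonal terms in the form with a free index `r ≠ i`.
    have hDD : ∫ ω, D ω ^ 2 ∂μ ≤ n * C ^ 2 := by
      have h1 : ∀ ω, D ω ^ 2 = ∑ i ∈ Finset.range n, ∑ r ∈ Finset.range n,
          ψ (X i ω) (X n ω) * ψ (X n ω) (X r ω) := by
        intro ω
        rw [sq]
        simp only [hD, Finset.sum_mul_sum, hsymm (X n ω)]
      simp_rw [h1]
      rw [integral_finsetSum _ fun i _ => integrable_finsetSum _ fun r _ => hint _ _ _ _]
      have h2 : ∀ i ∈ Finset.range n, ∫ ω, ∑ r ∈ Finset.range n,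
          ψ (X i ω) (X n ω) * ψ (X n ω) (X r ω) ∂μ ≤ C ^ 2 := by
        intro i hi
        rw [integral_finsetSum _ fun r _ => hint _ _ _ _, Finset.sum_eq_single_of_mem i hi]
        · have h3 : ∀ ω, ψ (X i ω) (X n ω) * ψ (X n ω) (X i ω) ≤ C ^ 2 := by
            intro ω
            rw [hsymm (X n ω), ← sq, ← sq_abs]
            exact pow_le_pow_left₀ (abs_nonneg _) (hC _ _) 2
          calc _ ≤ ∫ _, C ^ 2 ∂μ := integral_mono (hint _ _ _ _) (integrable_const _) h3
            _ = C ^ 2 := by simp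
        · intro r hr hri
          exact integral_degenerate_mul_eq_zero hψ hC h0 hindep hlaw hri.symm
            (Finset.mem_range.1 hr).ne' (Finset.mem_range.1 hr).ne'
      calc _ ≤ ∑ i ∈ Finset.range n, C ^ 2 := Finset.sum_le_sum h2
        _ = n * C ^ 2 := by simp
    have hsum : ∀ ω, (∑ s ∈ Finset.range (n + 1), ∑ r ∈ Finset.range s, ψ (X r ω) (X s ω)) ^ 2 =
        T ω ^ 2 + 2 * (T ω * D ω) + D ω ^ 2 := by
      intro ω
      rw [Finset.sum_range_succ]
      ring
    simp_rw [hsum]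
    have hTDi : Integrable (fun ω => 2 * (T ω * D ω)) μ := (hTm.integrable_mul hDm).const_mul 2
    have hsumi : Integrable (fun ω => T ω ^ 2 + 2 * (T ω * D ω)) μ := hTm.integrable_sq.add hTDi
    rw [integral_add hsumi hDm.integrable_sq, integral_add hTm.integrable_sq hTDi,
      integral_const_mul, hTD]
    push_cast
    nlinarith [mul_nonneg (sq_nonneg C) (Nat.cast_nonneg (α := ℝ) n), sq_nonneg C]

/-- The remainder of a U-statistic after subtraction of its Hájek projection vanishes in
probability, also after multiplication by `√n`. -/
lemma tendstoInMeasure_uStat_sub_projection {h : 𝓧 → 𝓧 → ℝ}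
    (hh : Measurable (Function.uncurry h)) (hsymm : ∀ x y, h x y = h y x) {C : ℝ}
    (hC : ∀ x y, |h x y| ≤ C) {g : 𝓧 → ℝ} (hg : Measurable g) {C' : ℝ} (hC' : ∀ x, |g x| ≤ C')
    {θ : ℝ} (hproj : ∀ x, ∫ y, h x y ∂ν = g x + θ) (hg0 : ∫ x, g x ∂ν = 0)
    (hindep : iIndepFun X μ) (hlaw : ∀ r, HasLaw (X r) ν μ) :
    TendstoInMeasure μ (fun (n : ℕ) ω => √n * (2 / ((n : ℝ) * ((n : ℝ) - 1)) *
        ∑ s ∈ Finset.range n, ∑ r ∈ Finset.range s, h (X r ω) (X s ω) - θ) -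
        (√n)⁻¹ * ∑ r ∈ Finset.range n, 2 * g (X r ω)) atTop 0 := by
  set ψ : 𝓧 → 𝓧 → ℝ := fun x y => h x y - θ - g x - g y with hψdef
  have hψ : Measurable (Function.uncurry ψ) :=
    ((hh.sub_const θ).sub (hg.comp measurable_fst)).sub (hg.comp measurable_snd)
  set K := C + |θ| + C' + C' with hK
  have hψC : ∀ x y, |ψ x y| ≤ K := by
    intro x y
    have h1 := hC x y
    have h2 := hC' x
    have h3 := hC' y
    have h4 := le_abs_self θ
    have h5 := neg_abs_le θ
    rw [abs_le] at h1 h2 h3 ⊢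
    constructor <;> simp only [hψdef, hK] <;> linarith [h1.1, h1.2, h2.1, h2.2, h3.1, h3.2]
  have hψ0 : ∀ x, ∫ y, ψ x y ∂ν = 0 := by
    intro x
    have hhi : Integrable (fun y => h x y) ν :=
      Integrable.of_bound (hh.comp (by fun_prop : Measurable fun y => (x, y))).aestronglyMeasurable
        C (ae_of_all _ fun y => hC x y)
    have hgi : Integrable g ν :=
      Integrable.of_bound hg.aestronglyMeasurable C' (ae_of_all _ fun y => hC' y)
    have hhi' : Integrable (fun y => h x y - θ) ν := hhi.sub (integrable_const _)
    have hhi'' : Integrable (fun y => h x y - θ - g x) ν := hhi'.sub (integrable_const _)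
    simp only [hψdef]
    rw [integral_sub hhi'' hgi, integral_sub hhi' (integrable_const _),
      integral_sub hhi (integrable_const _), hproj, hg0]
    simp
  set T : ℕ → Ω → ℝ := fun n ω => ∑ s ∈ Finset.range n, ∑ r ∈ Finset.range s, ψ (X r ω) (X s ω)
    with hT
  set c : ℕ → ℝ := fun n => √n * (2 / ((n : ℝ) * ((n : ℝ) - 1))) with hc
  have hTm : ∀ n, MemLp (T n) 2 μ := fun n => memLp_finsetSum _ fun s _ =>
    memLp_finsetSum _ fun r _ => MemLp.of_bound
      (aemeasurable_kernel hψ hlaw r s).aestronglyMeasurable K (ae_of_all _ fun ω => hψC _ _)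
  have hlim : TendstoInMeasure μ (fun n ω => c n * T n ω) atTop 0 := by
    refine tendstoInMeasure_zero_of_integral_sq (fun n => (hTm n).const_mul _) ?_
    refine tendsto_of_tendsto_of_tendsto_of_le_of_le' tendsto_const_nhds
      (tendsto_const_div_atTop_nhds_zero_nat (16 * K ^ 2))
      (Eventually.of_forall fun n => integral_nonneg fun ω => sq_nonneg _) ?_
    filter_upwards [eventually_ge_atTop 2] with n hn
    have hn' : (2 : ℝ) ≤ n := by exact_mod_cast hn
    simp_rw [mul_pow]
    rw [integral_const_mul]
    have h1 := integral_sq_degenerate_sum_le hψ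
      (fun x y => by simp only [hψdef, hsymm x y]; ring) hψC hψ0 hindep hlaw n
    refine (mul_le_mul_of_nonneg_left h1 (sq_nonneg _)).trans ?_
    have h2 : c n ^ 2 * (K ^ 2 * n ^ 2) = 4 * K ^ 2 * (n / ((n : ℝ) - 1) ^ 2) := by
      have : (n : ℝ) - 1 ≠ 0 := by linarith
      have : (n : ℝ) ≠ 0 := by linarith
      simp only [hc]
      rw [mul_pow, Real.sq_sqrt (by linarith)]
      field_simp
      ring
    -- `n ≤ 2 (n - 1)` because `n ≥ 2`; this is where the constant `16 = 4 * 4` comes from.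
    have h3 : (n : ℝ) / ((n : ℝ) - 1) ^ 2 ≤ 4 / n := by
      rw [div_le_div_iff₀ (by nlinarith) (by linarith)]
      nlinarith
    rw [h2]
    calc _ ≤ 4 * K ^ 2 * (4 / n) := by gcongr
      _ = 16 * K ^ 2 / n := by ring
  -- For `n ≤ 1` the normalization `2 / (n (n - 1))` is the junk value `0`.
  refine TendstoInMeasure.congr' ?_ (ae_eq_refl _) hlim
  filter_upwards [eventually_ge_atTop 2] with n hn
  refine ae_of_all _ fun ω => ?_
  have hn' : (2 : ℝ) ≤ n := by exact_mod_cast hn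
  have h1 : (n : ℝ) - 1 ≠ 0 := by linarith
  have h2 : (n : ℝ) ≠ 0 := by linarith
  have h3 : √(n : ℝ) ≠ 0 := (Real.sqrt_pos.2 (by linarith)).ne'
  have h4 : (√(n : ℝ))⁻¹ = √n / n := by
    rw [Real.sqrt_div_self]
  simp only [sum_pairs_eq_hoeffding h g θ (fun r => X r ω) n, hT, hψdef, hc, ← Finset.mul_sum, h4]
  field_simp
  ring

/-- The central limit theorem for vector-valued U-statistics of order two with a bounded symmetric
kernel `h` of mean `θ` and projection `g`. -/
theorem tendstoInDistribution_uStat {ι : Type*} [Fintype ι] [DecidableEq ι]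
    {h : 𝓧 → 𝓧 → ι → ℝ} (hh : ∀ k, Measurable (Function.uncurry fun x y => h x y k))
    (hsymm : ∀ x y, h x y = h y x) {C : ℝ} (hC : ∀ x y k, |h x y k| ≤ C)
    {g : 𝓧 → ι → ℝ} (hg : ∀ k, Measurable fun x => g x k) {C' : ℝ} (hC' : ∀ x k, |g x k| ≤ C')
    {θ : ι → ℝ} (hproj : ∀ x k, ∫ y, h x y k ∂ν = g x k + θ k) (hg0 : ∀ k, ∫ x, g x k ∂ν = 0)
    (hindep : iIndepFun X μ) (hlaw : ∀ r, HasLaw (X r) ν μ) :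
    TendstoInDistribution (fun (n : ℕ) ω => WithLp.toLp 2 (fun k =>
        √n * (2 / ((n : ℝ) * ((n : ℝ) - 1)) *
          ∑ s ∈ Finset.range n, ∑ r ∈ Finset.range s, h (X r ω) (X s ω) k - θ k))) atTop
      (id : EuclideanSpace ℝ ι → EuclideanSpace ℝ ι) (fun _ => μ)
      (multivariateGaussian 0
        (Matrix.of fun k l => 4 * cov[fun x => g x k, fun x => g x l; ν])) := by
  -- The factor `2` of the projection accounts for the `4` in the covariance matrix.
  set Y : ℕ → Ω → ι → ℝ := fun r ω k => 2 * g (X r ω) k with hY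
  have hgm : Measurable fun x => fun k => 2 * g x k :=
    measurable_pi_lambda _ fun k => (hg k).const_mul 2
  have hcov : covMatrix (Y 0) μ =
      Matrix.of fun k l => 4 * cov[fun x => g x k, fun x => g x l; ν] := by
    ext k l
    simp only [covMatrix, Matrix.of_apply, hY]
    rw [covariance_const_mul_left, covariance_const_mul_right,
      (hlaw 0).covariance_fun_comp (hg k).aemeasurable (hg l).aemeasurable]
    ring
  have hclt := tendstoInDistribution_multivariateGaussian (μ := μ) (Y := Y)
    (fun k => MemLp.of_bound
      (((hg k).comp_aemeasurable (hlaw 0).aemeasurable).const_mul 2).aestronglyMeasurable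
      (2 * C') (ae_of_all _ fun ω => by
        rw [Real.norm_eq_abs, abs_mul, abs_two]; gcongr; exact hC' _ _))
    (fun k => by
      have := (hlaw 0).integral_comp (hg k).aestronglyMeasurable
      simp only [Function.comp_def, hg0] at this
      simp only [hY, integral_const_mul, this, mul_zero])
    (hindep.comp (fun _ x k => 2 * g x k) fun _ => hgm)
    (fun n => (IdentDistrib.mk (hlaw n).aemeasurable (hlaw 0).aemeasurable
      ((hlaw n).map_eq.trans (hlaw 0).map_eq.symm)).comp hgm)
  rw [hcov] at hclt
  refine tendstoInDistribution_of_tendstoInMeasure_sub _ _ hclt ?_ fun n => ?_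
  · have hpi : TendstoInMeasure μ (fun (n : ℕ) ω k => √n * (2 / ((n : ℝ) * ((n : ℝ) - 1)) *
        ∑ s ∈ Finset.range n, ∑ r ∈ Finset.range s, h (X r ω) (X s ω) k - θ k) -
        (√n)⁻¹ * ∑ r ∈ Finset.range n, 2 * g (X r ω) k) atTop fun _ => 0 :=
      tendstoInMeasure_pi fun k => tendstoInMeasure_uStat_sub_projection (hh k)
        (fun x y => by rw [hsymm]) (fun x y => hC x y k) (hg k) (fun x => hC' x k)
        (fun x => hproj x k) (hg0 k) hindep hlaw
    have hcont : Continuous (WithLp.toLp 2 : (ι → ℝ) → EuclideanSpace ℝ ι) := by fun_prop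
    have := hpi.comp_continuousWithinAt (s := Set.univ) hcont.continuousAt.continuousWithinAt
      (Eventually.of_forall fun n => ae_of_all _ fun ω => Set.mem_univ _)
    convert this using 3 with n ω
    · ext k
      simp [hY, Finset.sum_apply]
    · rfl
  · refine (by fun_prop : Measurable
      (WithLp.toLp 2 : (ι → ℝ) → EuclideanSpace ℝ ι)).comp_aemeasurable ?_
    refine aemeasurable_pi_lambda _ fun k => ?_
    refine (((Finset.aemeasurable_fun_sum _ fun s _ => Finset.aemeasurable_fun_sum _ fun r _ =>
      aemeasurable_kernel (hh k) hlaw r s).const_mul _).sub_const _).const_mul _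

end UStatistic

/-! ### Kendall's tau -/

section Kendall

variable {d : ℕ} {ν : Measure (Fin d → ℝ)}

/-- A continuous joint distribution function gives null coordinate hyperplanes: a point of
`{x | x i = c, x ≤ M}` lies below `(M, …, c, …, M)` but not below `(M, …, c', …, M)` for
`c' < c`. -/
lemma measure_coord_eq_zero [IsProbabilityMeasure ν]
    (hν : Continuous fun x : Fin d → ℝ => ν.real (Set.Iic x)) (i : Fin d) (c : ℝ) :
    ν {x | x i = c} = 0 := by
  have hbox : ∀ M : ℕ, ν ({x | x i = c} ∩ Set.Iic fun _ => (M : ℝ)) = 0 := by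
    intro M
    set u : ℝ → Fin d → ℝ := fun e => Function.update (fun _ => (M : ℝ)) i e with hu
    have hcont : Continuous fun e => ν.real (Set.Iic (u e)) :=
      hν.comp (continuous_const.update i continuous_id)
    have hlim : Tendsto (fun e => ν.real (Set.Iic (u c)) - ν.real (Set.Iic (u e)))
        (nhdsWithin c (Set.Iio c)) (nhds 0) := by
      have := (hcont.tendsto c).const_sub (ν.real (Set.Iic (u c)))
      rw [sub_self] at this
      exact this.mono_left nhdsWithin_le_nhds
    have hle : ∀ᶠ e in nhdsWithin c (Set.Iio c),
        ν.real ({x | x i = c} ∩ Set.Iic fun _ => (M : ℝ)) ≤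
          ν.real (Set.Iic (u c)) - ν.real (Set.Iic (u e)) := by
      filter_upwards [self_mem_nhdsWithin] with e he
      have hsub : Set.Iic (u e) ⊆ Set.Iic (u c) := by
        refine Set.Iic_subset_Iic.2 fun j => ?_
        by_cases h : j = i
        · subst h; simpa [hu] using le_of_lt he
        · simp [hu, h]
      rw [← measureReal_sdiff hsub measurableSet_Iic]
      refine measureReal_mono ?_
      rintro x ⟨hx, hxM⟩
      refine ⟨fun j => ?_, fun hxe => ?_⟩
      · by_cases h : j = i
        · subst h; simpa [hu] using le_of_eq hx
        · simpa [hu, h] using hxM j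
      · have := hxe i
        simp only [hu, Function.update_self] at this
        exact absurd (hx ▸ this) (not_le.2 he)
    have h0 := ge_of_tendsto hlim hle
    rw [← measureReal_eq_zero_iff]
    exact le_antisymm h0 measureReal_nonneg
  refine measure_mono_null ?_ (measure_iUnion_null hbox)
  intro x hx
  obtain ⟨M, hM⟩ := exists_nat_ge ‖x‖
  exact Set.mem_iUnion.2 ⟨M, hx, fun j => (le_abs_self _).trans ((norm_le_pi_norm x j).trans hM)⟩

lemma measure_tie_eq_zero [IsProbabilityMeasure ν]
    (hν : Continuous fun x : Fin d → ℝ => ν.real (Set.Iic x)) (i : Fin d) :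
    (ν.prod ν) {z | z.1 i - z.2 i = 0} = 0 := by
  have hm : MeasurableSet {z : (Fin d → ℝ) × (Fin d → ℝ) | z.1 i - z.2 i = 0} :=
    measurableSet_eq_fun (by fun_prop) (by fun_prop)
  rw [Measure.measure_prod_null hm]
  refine ae_of_all _ fun x => ?_
  refine measure_mono_null ?_ (measure_coord_eq_zero hν i (x i))
  intro y hy
  have : x i - y i = 0 := hy
  simp only [Set.mem_ofPred_eq]
  linarith

lemma measurableSet_concordant (k : UpperPair d) :
    MeasurableSet {z : (Fin d → ℝ) × (Fin d → ℝ) |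
      0 < (z.1 k.1.1 - z.2 k.1.1) * (z.1 k.1.2 - z.2 k.1.2)} :=
  measurableSet_lt (by fun_prop) (by fun_prop)

lemma kendallKernel_eq_indicator (k : UpperPair d) :
    (Function.uncurry fun x y : Fin d → ℝ => kendallKernel x y k) = fun z =>
      2 * Set.indicator {z : (Fin d → ℝ) × (Fin d → ℝ) |
        0 < (z.1 k.1.1 - z.2 k.1.1) * (z.1 k.1.2 - z.2 k.1.2)} (fun _ => (1 : ℝ)) z - 1 := by
  ext z
  simp only [Function.uncurry, kendallKernel, Set.indicator, Set.mem_ofPred_eq]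

lemma measurable_kendallKernel (k : UpperPair d) :
    Measurable (Function.uncurry fun x y : Fin d → ℝ => kendallKernel x y k) := by
  rw [kendallKernel_eq_indicator]
  exact ((measurable_const.indicator (measurableSet_concordant k)).const_mul 2).sub_const 1

lemma kendallKernel_comm (x y : Fin d → ℝ) : kendallKernel x y = kendallKernel y x := by
  ext k
  simp only [kendallKernel]
  rw [show (x k.1.1 - y k.1.1) * (x k.1.2 - y k.1.2) =
    (y k.1.1 - x k.1.1) * (y k.1.2 - x k.1.2) by ring]

lemma abs_kendallKernel_le (x y : Fin d → ℝ) (k : UpperPair d) : |kendallKernel x y k| ≤ 1 := by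
  simp only [kendallKernel]
  split_ifs <;> norm_num

/-- In the absence of ties, Kendall's tau is the mean of the kernel `h`. -/
lemma integral_kendallKernel [IsProbabilityMeasure ν]
    (hν : Continuous fun x : Fin d → ℝ => ν.real (Set.Iic x)) (k : UpperPair d) :
    ∫ x, ∫ y, kendallKernel x y k ∂ν ∂ν = kendallTauVec ν k := by
  have hint : Integrable (Function.uncurry fun x y : Fin d → ℝ => kendallKernel x y k)
      (ν.prod ν) :=
    Integrable.of_bound (measurable_kendallKernel k).aestronglyMeasurable 1
      (ae_of_all _ fun z => abs_kendallKernel_le z.1 z.2 k)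
  rw [integral_integral hint]
  change ∫ z, (Function.uncurry fun x y : Fin d → ℝ => kendallKernel x y k) z ∂(ν.prod ν) = _
  rw [kendallKernel_eq_indicator, integral_sub
    (((integrable_const _).indicator (measurableSet_concordant k)).const_mul 2)
    (integrable_const _), integral_const_mul, integral_indicator_const _
    (measurableSet_concordant k)]
  have hcompl : {z : (Fin d → ℝ) × (Fin d → ℝ) |
      (z.1 k.1.1 - z.2 k.1.1) * (z.1 k.1.2 - z.2 k.1.2) < 0} =ᵐ[ν.prod ν]
      ({z | 0 < (z.1 k.1.1 - z.2 k.1.1) * (z.1 k.1.2 - z.2 k.1.2)}ᶜ : Set _) := by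
    have h1 : ∀ᵐ z ∂(ν.prod ν), ¬ (z.1 k.1.1 - z.2 k.1.1 = 0) := by
      rw [ae_iff]; simpa using measure_tie_eq_zero hν k.1.1
    have h2 : ∀ᵐ z ∂(ν.prod ν), ¬ (z.1 k.1.2 - z.2 k.1.2 = 0) := by
      rw [ae_iff]; simpa using measure_tie_eq_zero hν k.1.2
    filter_upwards [h1, h2] with z hz1 hz2
    refine propext ⟨fun h => not_lt.2 (le_of_lt h), fun h => lt_of_le_of_ne (not_lt.1 h) ?_⟩
    exact mul_ne_zero hz1 hz2
  rw [kendallTauVec, measureReal_congr hcompl, probReal_compl_eq_one_sub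
    (measurableSet_concordant k)]
  simp
  ring

lemma measurable_kendallProj [IsProbabilityMeasure ν] (k : UpperPair d) :
    Measurable fun x => kendallProj ν x k :=
  ((measurable_kendallKernel k).stronglyMeasurable.integral_prod_right).measurable.sub_const _

lemma abs_kendallProj_le [IsProbabilityMeasure ν] (x : Fin d → ℝ) (k : UpperPair d) :
    |kendallProj ν x k| ≤ 3 := by
  have h1 : |∫ y, kendallKernel x y k ∂ν| ≤ 1 := by
    have := norm_integral_le_of_norm_le_const (μ := ν) (C := 1) (f := fun y => kendallKernel x y k)
      (ae_of_all _ fun y => abs_kendallKernel_le x y k)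
    simpa using this
  have h2 : |kendallTauVec ν k| ≤ 2 := by
    refine (abs_sub _ _).trans ?_
    rw [abs_of_nonneg measureReal_nonneg, abs_of_nonneg measureReal_nonneg]
    exact (add_le_add measureReal_le_one measureReal_le_one).trans (by norm_num)
  refine (abs_sub _ _).trans ?_
  linarith

lemma integral_kendallProj [IsProbabilityMeasure ν]
    (hν : Continuous fun x : Fin d → ℝ => ν.real (Set.Iic x)) (k : UpperPair d) :
    ∫ x, kendallProj ν x k ∂ν = 0 := by
  have hint : Integrable (Function.uncurry fun x y : Fin d → ℝ => kendallKernel x y k)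
      (ν.prod ν) :=
    Integrable.of_bound (measurable_kendallKernel k).aestronglyMeasurable 1
      (ae_of_all _ fun z => abs_kendallKernel_le z.1 z.2 k)
  have hint' : Integrable (fun x => ∫ y, kendallKernel x y k ∂ν) ν := hint.integral_prod_left
  simp only [kendallProj]
  rw [integral_sub hint' (integrable_const _), integral_kendallKernel hν]
  simp

/-- The asymptotic normality of the empirical Kendall's tau vector. -/
theorem tendstoInDistribution_empiricalTauVec [IsProbabilityMeasure ν] {Ω : Type*}
    [MeasurableSpace Ω] {μ : Measure Ω} [IsProbabilityMeasure μ]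
    (hν : Continuous fun x : Fin d → ℝ => ν.real (Set.Iic x))
    {X : ℕ → Ω → Fin d → ℝ} (hindep : iIndepFun X μ) (hlaw : ∀ r, HasLaw (X r) ν μ) :
    TendstoInDistribution (fun (n : ℕ) ω => WithLp.toLp 2
        (√n • (empiricalTauVec n (fun r => X r ω) - kendallTauVec ν))) atTop
      (id : EuclideanSpace ℝ (UpperPair d) → EuclideanSpace ℝ (UpperPair d)) (fun _ => μ)
      (multivariateGaussian 0 (kendallCov ν)) :=
  tendstoInDistribution_uStat (h := kendallKernel) (g := kendallProj ν) (θ := kendallTauVec ν)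
    measurable_kendallKernel kendallKernel_comm abs_kendallKernel_le measurable_kendallProj
    abs_kendallProj_le (fun x k => by simp [kendallProj]) (integral_kendallProj hν) hindep hlaw

lemma posSemidef_kendallCov [IsProbabilityMeasure ν] : (kendallCov ν).PosSemidef := by
  have h : kendallCov ν = (4 : ℝ) • covMatrix (kendallProj ν) ν := by
    ext k l
    simp [kendallCov, covMatrix]
  rw [h]
  refine (posSemidef_covMatrix fun k => ?_).smul (by norm_num)
  exact MemLp.of_bound (measurable_kendallProj k).aestronglyMeasurable 3
    (ae_of_all _ fun x => abs_kendallProj_le x k)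

end Kendall

/-! ### The limit law of the standardized statistic -/

section Standardized

variable {ι : Type*} [Fintype ι] [DecidableEq ι]

lemma map_mulVec_multivariateGaussian {C : Matrix ι ι ℝ} (hC : C.PosSemidef) (A : Matrix ι ι ℝ) :
    (multivariateGaussian 0 C).map (fun z => WithLp.toLp 2 (A *ᵥ z.ofLp)) =
      multivariateGaussian 0 (A * C * Aᵀ) := by
  have hm : Measurable fun z : EuclideanSpace ℝ ι =>
      (WithLp.toLp 2 (A *ᵥ z.ofLp) : EuclideanSpace ℝ ι) :=
    Continuous.measurable (by fun_prop)
  have : IsProbabilityMeasure ((multivariateGaussian 0 C).map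
      (fun z => (WithLp.toLp 2 (A *ᵥ z.ofLp) : EuclideanSpace ℝ ι))) :=
    Measure.isProbabilityMeasure_map hm.aemeasurable
  have hACA : (A * C * Aᵀ).PosSemidef := by
    simpa using hC.mul_mul_conjTranspose_same A
  refine Measure.ext_of_charFun ?_
  ext t
  have h1 : charFun ((multivariateGaussian 0 C).map
      (fun z => (WithLp.toLp 2 (A *ᵥ z.ofLp) : EuclideanSpace ℝ ι))) t =
      charFun (multivariateGaussian 0 C) (WithLp.toLp 2 (Aᵀ *ᵥ t.ofLp)) := by
    rw [charFun_apply, charFun_apply, integral_map hm.aemeasurable (by fun_prop)]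
    refine integral_congr_ae (ae_of_all _ fun z => ?_)
    simp only [EuclideanSpace.inner_eq_star_dotProduct, star_trivial]
    rw [Matrix.dotProduct_mulVec, Matrix.mulVec_transpose]
  rw [h1, charFun_multivariateGaussian hC, charFun_multivariateGaussian hACA]
  simp only [inner_zero_right]
  rw [Matrix.mulVec_transpose, ← Matrix.mulVec_mulVec, ← Matrix.mulVec_mulVec,
    Matrix.dotProduct_mulVec t.ofLp A, Matrix.mulVec_transpose]

/-- The entries of `(S ω)^{-1/2}` are measurable, because `invSqrtMatrix` is continuous on the Borel
set of positive definite matrices, in which `S` almost surely lies. -/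
lemma aemeasurable_invSqrtMatrix {Ω : Type*} [MeasurableSpace Ω] {μ : Measure Ω}
    {S : Ω → Matrix ι ι ℝ} (hS : ∀ k l, AEMeasurable (fun ω => S ω k l) μ)
    (hpos : ∀ᵐ ω ∂μ, (S ω).PosDef) (k l : ι) :
    AEMeasurable (fun ω => invSqrtMatrix (S ω) k l) μ := by
  classical
  set D : Set (ι → ι → ℝ) := {A | Matrix.PosDef (Matrix.of A)} with hD
  have hDm : MeasurableSet D :=
    @measurableSet_posDef ι _ _ MeasurableSpace.pi (inferInstanceAs (BorelSpace (ι → ι → ℝ)))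
  have hF : ContinuousOn (fun A : ι → ι → ℝ => invSqrtMatrix (Matrix.of A) k l) D :=
    (continuous_apply_apply k l).comp_continuousOn (continuousOn_invSqrtMatrix (ι := ι))
  have hF' := hF.measurable_piecewise (continuousOn_const (c := (0 : ℝ))) hDm
  have hSm : AEMeasurable (fun ω => (fun k l => S ω k l : ι → ι → ℝ)) μ :=
    aemeasurable_pi_lambda _ fun k => aemeasurable_pi_lambda _ fun l => hS k l
  refine (hF'.comp_aemeasurable hSm).congr ?_
  filter_upwards [hpos] with ω hω
  exact Set.piecewise_eq_of_mem _ _ _ hω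

/-- If `n S n` and `P n` converge in probability to `Slim` and `Plim`, then the matrix
`n^{-1/2} (S n)^{-1/2} P n = (n S n)^{-1/2} P n` converges in probability to
`Slim^{-1/2} Plim`. -/
lemma tendstoInMeasure_invSqrtMatrix_mul {Ω : Type*} [MeasurableSpace Ω] {μ : Measure Ω}
    {S P : ℕ → Ω → Matrix ι ι ℝ} {Slim Plim : Matrix ι ι ℝ}
    (hSconv : ∀ k l,
      TendstoInMeasure μ (fun (n : ℕ) ω => (n : ℝ) * S n ω k l) atTop (fun _ => Slim k l))
    (hPconv : ∀ k l,
      TendstoInMeasure μ (fun (n : ℕ) ω => P n ω k l) atTop (fun _ => Plim k l))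
    (hSlim : Slim.PosDef) (hSpos : ∀ n, ∀ᵐ ω ∂μ, (S n ω).PosDef) :
    TendstoInMeasure μ
      (fun (n : ℕ) ω k l => ((√n)⁻¹ • (invSqrtMatrix (S n ω) * P n ω)) k l) atTop
      (fun _ k l => (invSqrtMatrix Slim * Plim) k l) := by
  have hS : TendstoInMeasure μ (fun (n : ℕ) ω k l => (n : ℝ) * S n ω k l) atTop
      (fun _ k l => Slim k l) :=
    tendstoInMeasure_pi fun k => tendstoInMeasure_pi fun l => hSconv k l
  have hP : TendstoInMeasure μ (fun (n : ℕ) ω k l => P n ω k l) atTop (fun _ k l => Plim k l) :=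
    tendstoInMeasure_pi fun k => tendstoInMeasure_pi fun l => hPconv k l
  have hcont : ContinuousWithinAt (fun p : (ι → ι → ℝ) × (ι → ι → ℝ) => fun k l =>
      (invSqrtMatrix (Matrix.of p.1) * Matrix.of p.2) k l)
      {p | (Matrix.of p.1).PosDef} (fun k l => Slim k l, fun k l => Plim k l) := by
    have h1 : ContinuousWithinAt (fun p : Matrix ι ι ℝ × Matrix ι ι ℝ => invSqrtMatrix p.1)
        {p | p.1.PosDef} (Slim, Plim) :=
      ContinuousWithinAt.comp (g := fun A : Matrix ι ι ℝ => invSqrtMatrix A)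
        (t := {A | A.PosDef}) (continuousOn_invSqrtMatrix Slim hSlim) continuousWithinAt_fst
        fun p hp => hp
    exact h1.mul continuousWithinAt_snd
  have hpos : ∀ᶠ n : ℕ in atTop, ∀ᵐ ω ∂μ,
      ((fun k l => (n : ℝ) * S n ω k l, fun k l => P n ω k l) : (ι → ι → ℝ) × (ι → ι → ℝ)) ∈
        {p : (ι → ι → ℝ) × (ι → ι → ℝ) | (Matrix.of p.1).PosDef} := by
    filter_upwards [eventually_gt_atTop 0] with n hn
    filter_upwards [hSpos n] with ω hω
    have h : ((n : ℝ) • S n ω).PosDef := hω.smul (Nat.cast_pos.2 hn)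
    exact h
  refine TendstoInMeasure.congr' ?_ (ae_eq_refl _)
    ((tendstoInMeasure_prodMk hS hP).comp_continuousWithinAt hcont hpos)
  filter_upwards [eventually_gt_atTop 0] with n hn
  filter_upwards [hSpos n] with ω hω
  have h1 : invSqrtMatrix (Matrix.of fun k l => (n : ℝ) * S n ω k l) =
      (√n)⁻¹ • invSqrtMatrix (S n ω) :=
    invSqrtMatrix_smul hω (Nat.cast_pos.2 hn)
  ext k l
  rw [h1, Matrix.smul_mul]
  rfl

/-- Slutsky's theorem for `(S n)^{-1/2} P n T n`, where `T n` is an asymptotically normal estimator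
of a vector `θ` annihilated by the matrices `P n`. -/
theorem tendstoInDistribution_invSqrtMatrix_mulVec {Ω : Type*} [MeasurableSpace Ω] {μ : Measure Ω}
    [IsProbabilityMeasure μ] {S P : ℕ → Ω → Matrix ι ι ℝ} {Slim Plim C : Matrix ι ι ℝ}
    {T : ℕ → Ω → ι → ℝ} {θ : ι → ℝ} (hT0 : T 0 = 0)
    (hT : TendstoInDistribution (fun (n : ℕ) ω => WithLp.toLp 2 (√n • (T n ω - θ))) atTop
      (id : EuclideanSpace ℝ ι → EuclideanSpace ℝ ι) (fun _ => μ) (multivariateGaussian 0 C))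
    (hC : C.PosSemidef)
    (hSmeas : ∀ n k l, AEMeasurable (fun ω => S n ω k l) μ)
    (hPmeas : ∀ n k l, AEMeasurable (fun ω => P n ω k l) μ)
    (hSconv : ∀ k l,
      TendstoInMeasure μ (fun (n : ℕ) ω => (n : ℝ) * S n ω k l) atTop (fun _ => Slim k l))
    (hPconv : ∀ k l,
      TendstoInMeasure μ (fun (n : ℕ) ω => P n ω k l) atTop (fun _ => Plim k l))
    (hSlim : Slim.PosDef) (hSpos : ∀ n, ∀ᵐ ω ∂μ, (S n ω).PosDef)
    (hPθ : ∀ n, ∀ᵐ ω ∂μ, P n ω *ᵥ θ = 0) :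
    TendstoInDistribution
      (fun (n : ℕ) ω => WithLp.toLp 2 (invSqrtMatrix (S n ω) *ᵥ (P n ω *ᵥ T n ω))) atTop
      (id : EuclideanSpace ℝ ι → EuclideanSpace ℝ ι) (fun _ => μ)
      (multivariateGaussian 0 (daggerMatrix Slim Plim C)) := by
  have hA := tendstoInMeasure_invSqrtMatrix_mul hSconv hPconv hSlim hSpos
  have hAm : ∀ n : ℕ, AEMeasurable
      (fun ω k l => ((√n)⁻¹ • (invSqrtMatrix (S n ω) * P n ω)) k l) μ := by
    intro n
    refine aemeasurable_pi_lambda _ fun k => aemeasurable_pi_lambda _ fun l => ?_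
    simp only [Matrix.smul_apply, Matrix.mul_apply, smul_eq_mul]
    exact (Finset.aemeasurable_fun_sum _ fun i _ =>
      (aemeasurable_invSqrtMatrix (hSmeas n) (hSpos n) k i).mul (hPmeas n i l)).const_mul _
  have hg : Continuous fun p : EuclideanSpace ℝ ι × (ι → ι → ℝ) =>
      (WithLp.toLp 2 (Matrix.of p.2 *ᵥ p.1.ofLp) : EuclideanSpace ℝ ι) := by
    have : Continuous fun p : EuclideanSpace ℝ ι × Matrix ι ι ℝ =>
      (WithLp.toLp 2 (p.2 *ᵥ p.1.ofLp) : EuclideanSpace ℝ ι) := by fun_prop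
    exact this
  have hslutsky := hT.continuous_comp_prodMk_of_tendstoInMeasure_const hg hA hAm
  have hlaw : (multivariateGaussian 0 C).map (fun z => (WithLp.toLp 2
      (Matrix.of (fun k l => (invSqrtMatrix Slim * Plim) k l) *ᵥ (id z).ofLp) :
        EuclideanSpace ℝ ι)) =
      (multivariateGaussian 0 (daggerMatrix Slim Plim C)).map id := by
    rw [Measure.map_id, daggerMatrix]
    refine (map_mulVec_multivariateGaussian hC (invSqrtMatrix Slim * Plim)).trans ?_
    rw [Matrix.transpose_mul, invSqrtMatrix_transpose]
    simp only [Matrix.mul_assoc]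
  refine (hslutsky.of_map_eq aemeasurable_id hlaw).congr (fun n => ?_) (ae_eq_refl _)
  filter_upwards [hPθ n] with ω hω
  rcases Nat.eq_zero_or_pos n with rfl | hn
  -- For `n = 0` the factor `(√0)⁻¹ = 0` makes one side vanish, and `T 0 = 0` the other.
  · simp [hT0]
  · have hn' : √(n : ℝ) ≠ 0 := (Real.sqrt_pos.2 (Nat.cast_pos.2 hn)).ne'
    congr 1
    change ((√(n : ℝ))⁻¹ • (invSqrtMatrix (S n ω) * P n ω)) *ᵥ (√(n : ℝ) • (T n ω - θ)) = _
    rw [Matrix.smul_mulVec, Matrix.mulVec_smul, inv_smul_smul₀ hn', ← Matrix.mulVec_mulVec,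
      Matrix.mulVec_sub, hω, sub_zero]

lemma posSemidef_daggerMatrix {C : Matrix ι ι ℝ} (hC : C.PosSemidef) (S P : Matrix ι ι ℝ) :
    (daggerMatrix S P C).PosSemidef := by
  have h : daggerMatrix S P C = (invSqrtMatrix S * P) * C * (invSqrtMatrix S * P)ᵀ := by
    rw [Matrix.transpose_mul, invSqrtMatrix_transpose, daggerMatrix]
    simp only [Matrix.mul_assoc]
  rw [h]
  simpa using hC.mul_mul_conjTranspose_same (invSqrtMatrix S * P)

end Standardized

theorem mainTheorem2 {d L : ℕ} {Ω : Type*} [MeasurableSpace Ω]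
    (μ : Measure Ω) [IsProbabilityMeasure μ]
    (ν : Measure (Fin d → ℝ)) [IsProbabilityMeasure ν]
    (hν : Continuous fun x : Fin d → ℝ => ν.real (Set.Iic x))
    (X : ℕ → Ω → Fin d → ℝ) (hindep : iIndepFun X μ) (hlaw : ∀ r, HasLaw (X r) ν μ)
    (B : Matrix (UpperPair d) (Fin L) ℝ) (hL : L < d * (d - 1) / 2) (hB : B.rank = L)
    (hH0 : ∃ β : Fin L → ℝ, (∀ l, β l ∈ Set.Icc (-1 : ℝ) 1) ∧ kendallTauVec ν = B *ᵥ β)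
    (S P : ℕ → Ω → Matrix (UpperPair d) (UpperPair d) ℝ)
    (Slim Plim : Matrix (UpperPair d) (UpperPair d) ℝ)
    (hSmeas : ∀ n k l, AEMeasurable (fun ω => S n ω k l) μ)
    (hPmeas : ∀ n k l, AEMeasurable (fun ω => P n ω k l) μ)
    (hSconv : ∀ k l,
      TendstoInMeasure μ (fun (n : ℕ) ω => (n : ℝ) * S n ω k l) atTop (fun _ => Slim k l))
    (hPconv : ∀ k l,
      TendstoInMeasure μ (fun (n : ℕ) ω => P n ω k l) atTop (fun _ => Plim k l))
    (hSlim : Slim.PosDef)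
    (hSpos : ∀ n, ∀ᵐ ω ∂μ, (S n ω).PosDef)
    (hPtau : ∀ n, ∀ᵐ ω ∂μ, P n ω *ᵥ kendallTauVec ν = 0) :
    TendstoInDistribution
      (fun (n : ℕ) ω => ‖WithLp.toLp 2 (invSqrtMatrix (S n ω) *ᵥ
        (P n ω *ᵥ empiricalTauVec n (fun r => X r ω)))‖ ^ 2)
      atTop
      (fun q : nonzeroEigenvalues (daggerMatrix Slim Plim (kendallCov ν)) → ℝ =>
        ∑ a : nonzeroEigenvalues (daggerMatrix Slim Plim (kendallCov ν)), (a : ℝ) * q a)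
      (fun _ => μ)
      (Measure.pi fun a : nonzeroEigenvalues (daggerMatrix Slim Plim (kendallCov ν)) =>
        chiSquaredLaw (geomMultiplicity (daggerMatrix Slim Plim (kendallCov ν)) a)) ∧
    TendstoInDistribution
      (fun (n : ℕ) ω => ‖invSqrtMatrix (S n ω) *ᵥ
        (P n ω *ᵥ empiricalTauVec n (fun r => X r ω))‖)
      atTop
      (fun z : EuclideanSpace ℝ (UpperPair d) => ‖WithLp.ofLp z‖)
      (fun _ => μ)
      (multivariateGaussian 0 (daggerMatrix Slim Plim (kendallCov ν))) := by
  have hC := posSemidef_kendallCov (ν := ν)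
  have hZ := tendstoInDistribution_invSqrtMatrix_mulVec
    (T := fun n ω => empiricalTauVec n fun r => X r ω)
    (by ext ω k; simp [empiricalTauVec]) (tendstoInDistribution_empiricalTauVec hν hindep hlaw)
    hC hSmeas hPmeas hSconv hPconv hSlim hSpos hPtau
  refine ⟨?_, hZ.continuous_comp (g := fun z => ‖WithLp.ofLp z‖) (by fun_prop)⟩
  refine (hZ.continuous_comp (g := fun z => ‖z‖ ^ 2) (by fun_prop)).of_map_eq
    (Measurable.aemeasurable (by fun_prop)) ?_
  exact map_norm_sq_multivariateGaussian_eq_chiSquared (posSemidef_daggerMatrix hC Slim Plim)
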